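/- Write $\widehat{\mathbb C}=\mathbb C\cup\{\infty\}$ and let $d\ge 1$. For $f=\sum_{0\le i,j\le d}A_{(i,j)}x^iy^j\in\mathbb C[x,y]$ let $$F([\xi:x],[\zeta:y])=\sum_{0\le i,j\le d}A_{(i,j)}\,x^i\xi^{d-i}y^j\zeta^{d-j}$$ and let $\Gamma_f\subset\widehat{\mathbb C}\times\widehat{\mathbb C}$ be the zero set of $F$, where $x\in\mathbb C$ is identified with $[1:x]$ and $\infty$ with $[0:1]$. We call $f$ a correspondence of degree $d$ if (i) for all but finitely many $x_0\in\mathbb C$ the polynomial $f(x_0,\cdot)$ has exactly $d$ zeros in $\mathbb C$ counted with multiplicity, and likewise for $f(\cdot,y_0)$ for all but finitely many $y_0\in\mathbb C$; and (ii) $\Gamma_f$ contains no set $\{a\}\times\widehat{\mathbb C}$ or $\widehat{\mathbb C}\times\{a\}$ with $a\in\widehat{\mathbb C}$. For $x_1\in\widehat{\mathbb C}$ let $Y_f(x_1)$ be the multiset of the $d$ zeros in $\widehat{\mathbb C}$ of the binary form $F(x_1,\cdot)$ of degree $d$, counted with multiplicity, and for $y_1\in\widehat{\mathbb C}$ let $X_f(y_1)$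 be the multiset of the $d$ zeros of $F(\cdot,y_1)$. A correspondence $f$ of degree $d$ is called a map of $d$-tuples if for every $x_1\in\widehat{\mathbb C}$ the multisets $X_f(y)$, $y\in Y_f(x_1)$, all coincide, and for every $y_1\in\widehat{\mathbb C}$ the multisets $Y_f(x)$, $x\in X_f(y_1)$, all coincide. **Theorem.** Let $d\ge 2$ and let $f_d=\sum_{0\le i,j\le d}A_{(i,j)}x^iy^j\in\mathbb C[x,y]$ be a correspondence of degree $d$. Then $f_d$ is a map of $d$-tuples if and only if at least one of the following holds: 1. $f_d=g_k^{\,d/k}$ for some divisor $k$ of $d$ with $k\neq d$ and some $g_k\in\mathbb C[x,y]$ that is a map of $k$-tuples; 2. the $(d+1)\times(d+1)$ matrix $\big(A_{(d-r,\,d-c)}\big)_{0\le r,c\le d}$ of coefficients of $f_d$ has rank exactly $2$. -/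

import Mathlib

open Polynomial
open scoped Polynomial.Bivariate

namespace TupleCorrespondence

noncomputable section

/-- The coefficient `A_(i, j)` of `x ^ i * y ^ j` in `f ∈ ℂ[x, y]`. The ring `ℂ[x, y]` is
`ℂ[X][Y]`: the inner variable is `x`, the outer variable is `y`. -/
def coef (f : ℂ[X][Y]) (i j : ℕ) : ℂ := (f.coeff j).coeff i

/-- Homogeneous coordinates `[ξ : x]` of a point of the Riemann sphere: a complex number `x` is
`[1 : x]` and the point at infinity is `[0 : 1]`. -/
def homCoord : OnePoint ℂ → ℂ × ℂ
  | none => (0, 1)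
  | some x => (1, x)

/-- The bihomogenisation `F([ξ : x], [ζ : y])` of bidegree `(d, d)`, evaluated at
`u = (ξ, x)` and `v = (ζ, y)`. -/
def bihomog (d : ℕ) (f : ℂ[X][Y]) (u v : ℂ × ℂ) : ℂ :=
  ∑ i ∈ Finset.range (d + 1), ∑ j ∈ Finset.range (d + 1),
    coef f i j * (u.2 ^ i * u.1 ^ (d - i)) * (v.2 ^ j * v.1 ^ (d - j))

/-- The biprojective completion `Γ_f` of `{f = 0}` in the product of two Riemann spheres. -/
def completion (d : ℕ) (f : ℂ[X][Y]) : Set (OnePoint ℂ × OnePoint ℂ) :=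
  {p | bihomog d f (homCoord p.1) (homCoord p.2) = 0}

/-- `f` is a polynomial correspondence of degree `d`: `f(x, ·)` and `f(·, y)` are generically
`d`-valued (values counted with multiplicity), and the completion of `{f = 0}` has no component
`{a} × Ĉ` or `Ĉ × {a}`. (The completion is a curve, so such a line is an irreducible component
exactly when it is contained in the completion.) -/
structure IsCorrespondence (d : ℕ) (f : ℂ[X][Y]) : Prop where
  generic_left : ∀ᶠ x : ℂ in Filter.cofinite,
    Multiset.card (f.map (evalRingHom x)).roots = d
  generic_right : ∀ᶠ y : ℂ in Filter.cofinite,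
    Multiset.card (f.eval (C y)).roots = d
  no_vertical : ∀ a : OnePoint ℂ, ¬ ({a} ×ˢ Set.univ ⊆ completion d f)
  no_horizontal : ∀ a : OnePoint ℂ, ¬ (Set.univ ×ˢ {a} ⊆ completion d f)

/-- The zeros on the Riemann sphere, with multiplicity, of the binary form
`∑ j ≤ d, c_j t ^ j s ^ (d - j)` of degree `d` attached to a nonzero polynomial
`P = ∑ j ≤ d, c_j t ^ j`. The order of vanishing at infinity `s = 0` is `d - deg P`. -/
def sphereRoots (d : ℕ) (P : ℂ[X]) : Multiset (OnePoint ℂ) :=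
  P.roots.map (fun z : ℂ => (z : OnePoint ℂ)) +
    Multiset.replicate (d - P.natDegree) OnePoint.infty

/-- The restriction of the bihomogenisation to `{p} × Ĉ`, as a polynomial in the affine
coordinate `y` (that is, with `ζ = 1`). -/
def sliceLeft (d : ℕ) (f : ℂ[X][Y]) (p : OnePoint ℂ) : ℂ[X] :=
  ∑ j ∈ Finset.range (d + 1),
    C (∑ i ∈ Finset.range (d + 1),
      coef f i j * ((homCoord p).2 ^ i * (homCoord p).1 ^ (d - i))) * X ^ j

/-- The restriction of the bihomogenisation to `Ĉ × {q}`, as a polynomial in the affine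
coordinate `x` (that is, with `ξ = 1`). -/
def sliceRight (d : ℕ) (f : ℂ[X][Y]) (q : OnePoint ℂ) : ℂ[X] :=
  ∑ i ∈ Finset.range (d + 1),
    C (∑ j ∈ Finset.range (d + 1),
      coef f i j * ((homCoord q).2 ^ j * (homCoord q).1 ^ (d - j))) * X ^ i

/-- The list of points `y` of `Γ_f` above `x = p`, repeated according to the intersection
multiplicity of `{p} × Ĉ` with `Γ_f`. -/
def imageList (d : ℕ) (f : ℂ[X][Y]) (p : OnePoint ℂ) : Multiset (OnePoint ℂ) :=
  sphereRoots d (sliceLeft d f p)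

/-- The list of points `x` of `Γ_f` above `y = q`, repeated according to the intersection
multiplicity of `Ĉ × {q}` with `Γ_f`. -/
def preimageList (d : ℕ) (f : ℂ[X][Y]) (q : OnePoint ℂ) : Multiset (OnePoint ℂ) :=
  sphereRoots d (sliceRight d f q)

/-- The degree `d` correspondence `f` is a map of `d`-tuples: for every `x₁`, the lists of
preimages of the images `y_j` of `x₁` coincide, and symmetrically for every `y₁`. -/
structure IsMapOfTuples (d : ℕ) (f : ℂ[X][Y]) : Prop where
  isCorrespondence : IsCorrespondence d f
  left : ∀ x₁ : OnePoint ℂ, ∀ y ∈ imageList d f x₁, ∀ y' ∈ imageList d f x₁,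
    preimageList d f y = preimageList d f y'
  right : ∀ y₁ : OnePoint ℂ, ∀ x ∈ preimageList d f y₁, ∀ x' ∈ preimageList d f y₁,
    imageList d f x = imageList d f x'

/-- The `(d + 1) × (d + 1)` matrix of coefficients, with `A_(d, d)` in the top left corner and
`A_(0, 0)` in the bottom right corner. -/
def coeffMatrix (d : ℕ) (f : ℂ[X][Y]) : Matrix (Fin (d + 1)) (Fin (d + 1)) ℂ :=
  Matrix.of fun r c => coef f (d - (r : ℕ)) (d - (c : ℕ))

end

end TupleCorrespondence

/-! Let `A` be the coefficient matrix and `v(q)` the point of the rational normal curve attached to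
`q`. Then `F(p, q) = v(p) · A v(q)`, and the slice `F(·, q)` has coefficient vector `A v(q)`. If `A`
has rank 2, then for fixed `x` the vectors `A v(y)` with `y` above `x` lie in the kernel of a
nonzero functional on the plane `range A`. That kernel is a line, so the slices are proportional and
have the same zeros (`preimageList_eq_of_rank_eq_two`). Transposing gives the other half.
Conversely, let `f` be a map of tuples. Over a generic `x`, counting `x` in the coinciding preimage
lists shows that all irreducible factors of `f` have one multiplicity `e`
(`IsMapOfTuples.emultiplicity_eq`), so `f = g ^ e`. If `e ≠ 1`, all lists of `f` are `e` times those
of `g`, so `g` is a map of tuples. If `e = 1`, some fibre has `d` distinct points with proportional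
slices, which forces rank at most 2 (`rank_le_two_of_slices_proportional`). Rank at most 1 would put
a line in the completion (`two_le_rank`). -/

namespace TupleCorrespondence

open Polynomial.Bivariate

/-! ### Slices and exchange of the two variables. -/

@[simp] lemma homCoord_infty : homCoord OnePoint.infty = (0, 1) := rfl

@[simp] lemma homCoord_coe (x : ℂ) : homCoord (x : OnePoint ℂ) = (1, x) := rfl

lemma coeff_coeff_swap (f : ℂ[X][Y]) (i j : ℕ) :
    ((swap f).coeff j).coeff i = (f.coeff i).coeff j := by
  induction f using Polynomial.induction_on' with
  | add p q hp hq => simp [hp, hq]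
  | monomial n a =>
    induction a using Polynomial.induction_on' with
    | add p q hp hq => simp_all [map_add]
    | monomial m r =>
      rw [swap_monomial_monomial]
      simp only [coeff_monomial]
      split_ifs <;> simp_all [coeff_monomial]

lemma coef_swap (f : ℂ[X][Y]) (i j : ℕ) : coef (swap f) i j = coef f j i :=
  coeff_coeff_swap f i j

lemma map_evalRingHom_swap (f : ℂ[X][Y]) (x : ℂ) :
    (swap f).map (evalRingHom x) = f.eval (C x) := by
  induction f using Polynomial.induction_on' with
  | add p q hp hq => simp [hp, hq]
  | monomial n a =>
    rw [swap_monomial, Polynomial.map_mul, Polynomial.map_map]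
    have : (evalRingHom x).comp C = RingHom.id ℂ := by ext; simp
    simp [this]

lemma evalEval_swap (f : ℂ[X][Y]) (x y : ℂ) : (swap f).evalEval x y = f.evalEval y x := by
  rw [← map_evalRingHom_eval, map_evalRingHom_swap]

lemma sliceRight_eq (d : ℕ) (f : ℂ[X][Y]) (q : OnePoint ℂ) :
    sliceRight d f q = sliceLeft d (swap f) q := by
  simp only [sliceRight, sliceLeft, coef_swap]

lemma sliceRight_swap (d : ℕ) (f : ℂ[X][Y]) (q : OnePoint ℂ) :
    sliceRight d (swap f) q = sliceLeft d f q := by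
  rw [sliceRight_eq, swap_swap_apply]

lemma preimageList_eq (d : ℕ) (f : ℂ[X][Y]) (q : OnePoint ℂ) :
    preimageList d f q = imageList d (swap f) q := by
  rw [preimageList, imageList, sliceRight_eq]

lemma preimageList_swap (d : ℕ) (f : ℂ[X][Y]) (q : OnePoint ℂ) :
    preimageList d (swap f) q = imageList d f q := by
  rw [preimageList_eq, swap_swap_apply]

lemma bihomog_swap (d : ℕ) (f : ℂ[X][Y]) (u v : ℂ × ℂ) :
    bihomog d (swap f) u v = bihomog d f v u := by
  rw [bihomog, bihomog, Finset.sum_comm]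
  refine Finset.sum_congr rfl fun i _ => Finset.sum_congr rfl fun j _ => ?_
  rw [coef_swap]
  ring

lemma coeff_sliceLeft (d : ℕ) (f : ℂ[X][Y]) (p : OnePoint ℂ) (n : ℕ) :
    (sliceLeft d f p).coeff n = if n ≤ d then
      ∑ i ∈ Finset.range (d + 1), coef f i n * ((homCoord p).2 ^ i * (homCoord p).1 ^ (d - i))
      else 0 := by
  simp only [sliceLeft, finsetSum_coeff, coeff_C_mul, coeff_X_pow, mul_ite, mul_one, mul_zero,
    Finset.sum_ite_eq, Finset.mem_range, Nat.lt_succ_iff]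

lemma natDegree_sliceLeft_le (d : ℕ) (f : ℂ[X][Y]) (p : OnePoint ℂ) :
    (sliceLeft d f p).natDegree ≤ d := by
  rw [natDegree_le_iff_coeff_eq_zero]
  intro n hn
  rw [coeff_sliceLeft, if_neg (by omega)]

lemma bihomog_eq_sum_coeff_sliceLeft (d : ℕ) (f : ℂ[X][Y]) (p : OnePoint ℂ) (v : ℂ × ℂ) :
    bihomog d f (homCoord p) v =
      ∑ j ∈ Finset.range (d + 1), (sliceLeft d f p).coeff j * (v.2 ^ j * v.1 ^ (d - j)) := by
  rw [bihomog, Finset.sum_comm]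
  refine Finset.sum_congr rfl fun j hj => ?_
  rw [coeff_sliceLeft, if_pos (by simpa [Nat.lt_succ_iff] using hj), Finset.sum_mul]

lemma bihomog_coe (d : ℕ) (f : ℂ[X][Y]) (p : OnePoint ℂ) (y : ℂ) :
    bihomog d f (homCoord p) (homCoord (y : OnePoint ℂ)) = (sliceLeft d f p).eval y := by
  rw [bihomog_eq_sum_coeff_sliceLeft,
    eval_eq_sum_range' (Nat.lt_succ_of_le (natDegree_sliceLeft_le d f p))]
  simp

lemma bihomog_infty (d : ℕ) (f : ℂ[X][Y]) (p : OnePoint ℂ) :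
    bihomog d f (homCoord p) (homCoord OnePoint.infty) = (sliceLeft d f p).coeff d := by
  rw [bihomog_eq_sum_coeff_sliceLeft, Finset.sum_eq_single d]
  · simp
  · intro j hj hjd
    have : d - j ≠ 0 := by
      have := Finset.mem_range.1 hj
      omega
    simp [this]
  · simp

/-- The slice must be nonzero: `sphereRoots d 0` is `d` copies of infinity, whereas the zero form
vanishes everywhere. -/
lemma mem_imageList {d : ℕ} {f : ℂ[X][Y]} {p : OnePoint ℂ} (h : sliceLeft d f p ≠ 0)
    (q : OnePoint ℂ) :
    q ∈ imageList d f p ↔ bihomog d f (homCoord p) (homCoord q) = 0 := by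
  have hd := natDegree_sliceLeft_le d f p
  induction q using OnePoint.rec with
  | infty =>
    rw [bihomog_infty, imageList, sphereRoots]
    simp only [Multiset.mem_add, Multiset.mem_map, OnePoint.coe_ne_infty, and_false,
      exists_false, false_or, Multiset.mem_replicate, and_true]
    constructor
    · intro h1
      exact coeff_eq_zero_of_natDegree_lt (by omega)
    · intro h1 h2
      apply h
      rw [← leadingCoeff_eq_zero, leadingCoeff, show (sliceLeft d f p).natDegree = d by omega, h1]
  | coe y =>
    rw [bihomog_coe, imageList, sphereRoots]
    simp only [Multiset.mem_add, Multiset.mem_map, OnePoint.coe_eq_coe, exists_eq_right,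
      Multiset.mem_replicate, OnePoint.coe_ne_infty, and_false, or_false, mem_roots h, IsRoot.def]

lemma mem_completion (d : ℕ) (f : ℂ[X][Y]) (p q : OnePoint ℂ) :
    (p, q) ∈ completion d f ↔ bihomog d f (homCoord p) (homCoord q) = 0 :=
  Iff.rfl

lemma forall_mem_completion_iff (d : ℕ) (f : ℂ[X][Y]) (a : OnePoint ℂ) :
    (∀ q, (a, q) ∈ completion d f) ↔ sliceLeft d f a = 0 := by
  simp only [mem_completion]
  constructor
  · intro h
    refine Polynomial.funext fun y => ?_
    rw [← bihomog_coe, eval_zero, h]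
  · intro h q
    rw [bihomog_eq_sum_coeff_sliceLeft, h]
    simp

lemma vertical_subset_iff (d : ℕ) (f : ℂ[X][Y]) (a : OnePoint ℂ) :
    {a} ×ˢ Set.univ ⊆ completion d f ↔ sliceLeft d f a = 0 := by
  rw [← forall_mem_completion_iff]
  constructor
  · intro h q
    exact h (Set.mk_mem_prod rfl trivial)
  · rintro h ⟨b, q⟩ hb
    obtain rfl : b = a := hb.1
    exact h q

lemma horizontal_subset_iff (d : ℕ) (f : ℂ[X][Y]) (a : OnePoint ℂ) :
    Set.univ ×ˢ {a} ⊆ completion d f ↔ sliceRight d f a = 0 := by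
  rw [sliceRight_eq, ← forall_mem_completion_iff]
  simp only [mem_completion, bihomog_swap]
  constructor
  · intro h q
    have : (q, a) ∈ completion d f := h (Set.mk_mem_prod trivial rfl)
    rwa [mem_completion] at this
  · rintro h ⟨q, b⟩ hb
    obtain rfl : b = a := hb.2
    rw [mem_completion]
    exact h q

lemma isCorrespondence_iff (d : ℕ) (f : ℂ[X][Y]) :
    IsCorrespondence d f ↔
      (∀ᶠ x : ℂ in Filter.cofinite, Multiset.card (f.map (evalRingHom x)).roots = d) ∧
      (∀ᶠ y : ℂ in Filter.cofinite, Multiset.card (f.eval (C y)).roots = d) ∧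
      (∀ a, sliceLeft d f a ≠ 0) ∧ ∀ a, sliceRight d f a ≠ 0 := by
  constructor
  · intro h
    refine ⟨h.1, h.2, fun a ha => h.3 a ?_, fun a ha => h.4 a ?_⟩
    · rwa [vertical_subset_iff]
    · rwa [horizontal_subset_iff]
  · intro h
    refine ⟨h.1, h.2.1, fun a ha => h.2.2.1 a ?_, fun a ha => h.2.2.2 a ?_⟩
    · rwa [← vertical_subset_iff]
    · rwa [← horizontal_subset_iff]

variable {d : ℕ} {f : ℂ[X][Y]}

lemma IsCorrespondence.sliceLeft_ne_zero (h : IsCorrespondence d f) (a : OnePoint ℂ) :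
    sliceLeft d f a ≠ 0 :=
  ((isCorrespondence_iff d f).1 h).2.2.1 a

lemma IsCorrespondence.sliceRight_ne_zero (h : IsCorrespondence d f) (a : OnePoint ℂ) :
    sliceRight d f a ≠ 0 :=
  ((isCorrespondence_iff d f).1 h).2.2.2 a

lemma IsCorrespondence.swap (h : IsCorrespondence d f) : IsCorrespondence d (swap f) := by
  rw [isCorrespondence_iff] at h ⊢
  refine ⟨?_, ?_, ?_, ?_⟩
  · simpa only [map_evalRingHom_swap] using h.2.1
  · simpa only [← map_evalRingHom_swap, swap_swap_apply] using h.1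
  · simpa only [← sliceRight_eq] using h.2.2.2
  · simpa only [sliceRight_swap] using h.2.2.1

lemma IsMapOfTuples.swap (h : IsMapOfTuples d f) : IsMapOfTuples d (swap f) := by
  refine ⟨h.1.swap, ?_, ?_⟩
  · simpa only [preimageList_swap, ← preimageList_eq] using h.right
  · simpa only [preimageList_swap, ← preimageList_eq] using h.left

/-! ### Degrees of a correspondence and behaviour under powers. -/

lemma eventually_eval_ne_zero {R : ℂ[X]} (hR : R ≠ 0) :
    ∀ᶠ x : ℂ in Filter.cofinite, R.eval x ≠ 0 := by
  rw [Filter.eventually_cofinite]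
  refine R.roots.toFinset.finite_toSet.subset fun x hx => ?_
  simpa [hR] using hx

lemma eventually_natDegree_map (hf : f ≠ 0) :
    ∀ᶠ x : ℂ in Filter.cofinite, (f.map (evalRingHom x)).natDegree = f.natDegree := by
  filter_upwards [eventually_eval_ne_zero (leadingCoeff_ne_zero.2 hf)] with x hx
  exact natDegree_map_of_leadingCoeff_ne_zero _ hx

lemma IsCorrespondence.ne_zero (h : IsCorrespondence d f) : f ≠ 0 := by
  rintro rfl
  apply h.sliceLeft_ne_zero OnePoint.infty
  ext n
  simp [coeff_sliceLeft, coef]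

lemma IsCorrespondence.natDegree (h : IsCorrespondence d f) : f.natDegree = d := by
  obtain ⟨x, hx, hx'⟩ := (h.generic_left.and (eventually_natDegree_map h.ne_zero)).exists
  rw [← hx', ← hx, (IsAlgClosed.splits _).natDegree_eq_card_roots]

lemma IsCorrespondence.natDegree_swap (h : IsCorrespondence d f) :
    (Bivariate.swap f).natDegree = d :=
  h.swap.natDegree

lemma sliceLeft_coe (h : f.natDegree ≤ d) (h' : (swap f).natDegree ≤ d) (x : ℂ) :
    sliceLeft d f x = f.map (evalRingHom x) := by
  ext n
  rw [coeff_sliceLeft, coeff_map]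
  split_ifs with hn
  · rw [coe_evalRingHom, eval_eq_sum_range' (n := d + 1)]
    · simp [coef]
    · rw [Nat.lt_succ_iff, natDegree_le_iff_coeff_eq_zero]
      intro m hm
      rw [← coeff_coeff_swap, coeff_eq_zero_of_natDegree_lt (h'.trans_lt hm), coeff_zero]
  · rw [coeff_eq_zero_of_natDegree_lt (by omega), map_zero]

lemma sliceLeft_infty (h : f.natDegree ≤ d) :
    sliceLeft d f OnePoint.infty = (swap f).coeff d := by
  ext n
  rw [coeff_sliceLeft, coeff_coeff_swap]
  split_ifs with hn
  · rw [Finset.sum_eq_single d]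
    · simp [coef]
    · intro j hj hjd
      have : d - j ≠ 0 := by
        have := Finset.mem_range.1 hj
        omega
      simp [this]
    · simp
  · rw [coeff_eq_zero_of_natDegree_lt (h.trans_lt (not_le.1 hn)), coeff_zero]

lemma sliceLeft_pow (h : f.natDegree ≤ d) (h' : (swap f).natDegree ≤ d) (e : ℕ)
    (p : OnePoint ℂ) : sliceLeft (e * d) (f ^ e) p = sliceLeft d f p ^ e := by
  have h1 : (f ^ e).natDegree ≤ e * d := natDegree_pow_le_of_le e h
  have h2 : (swap (f ^ e)).natDegree ≤ e * d := by
    rw [map_pow]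
    exact natDegree_pow_le_of_le e h'
  induction p using OnePoint.rec with
  | infty => rw [sliceLeft_infty h1, sliceLeft_infty h, map_pow, coeff_pow_of_natDegree_le h']
  | coe x => rw [sliceLeft_coe h1 h2, sliceLeft_coe h h', Polynomial.map_pow]

lemma sphereRoots_pow (P : ℂ[X]) (k e : ℕ) :
    sphereRoots (e * k) (P ^ e) = e • sphereRoots k P := by
  rw [sphereRoots, sphereRoots, roots_pow, natDegree_pow, ← Nat.mul_sub, Multiset.map_nsmul,
    nsmul_add, Multiset.nsmul_replicate]

lemma imageList_pow (h : f.natDegree ≤ d) (h' : (swap f).natDegree ≤ d) (e : ℕ)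
    (p : OnePoint ℂ) : imageList (e * d) (f ^ e) p = e • imageList d f p := by
  rw [imageList, sliceLeft_pow h h', sphereRoots_pow, imageList]

lemma preimageList_pow (h : f.natDegree ≤ d) (h' : (swap f).natDegree ≤ d) (e : ℕ)
    (p : OnePoint ℂ) : preimageList (e * d) (f ^ e) p = e • preimageList d f p := by
  rw [preimageList_eq, map_pow, imageList_pow h' (by rwa [swap_swap_apply]), preimageList_eq]

lemma nsmul_multiset_inj {α : Type*} {e : ℕ} (he : e ≠ 0) {s t : Multiset α} :
    e • s = e • t ↔ s = t := by
  classical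
  refine ⟨fun h => Multiset.ext.2 fun a => ?_, fun h => h ▸ rfl⟩
  have := congrArg (Multiset.count a) h
  simpa [he] using this

/-- Raising to the power `e` repeats every list `e` times, which changes neither membership nor
equality of lists. -/
lemma isMapOfTuples_pow_iff {g : ℂ[X][Y]} {k e : ℕ} (he : e ≠ 0) (hg : IsCorrespondence k g)
    (hf : IsCorrespondence (e * k) (g ^ e)) :
    IsMapOfTuples (e * k) (g ^ e) ↔ IsMapOfTuples k g := by
  have h1 := imageList_pow hg.natDegree.le hg.natDegree_swap.le e
  have h2 := preimageList_pow hg.natDegree.le hg.natDegree_swap.le e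
  constructor
  · rintro ⟨-, hl, hr⟩
    simp only [h1, h2, nsmul_multiset_inj he, Multiset.mem_nsmul_of_ne_zero he] at hl hr
    exact ⟨hg, hl, hr⟩
  · rintro ⟨-, hl, hr⟩
    refine ⟨hf, ?_, ?_⟩
    · simpa only [h1, h2, nsmul_multiset_inj he, Multiset.mem_nsmul_of_ne_zero he] using hl
    · simpa only [h1, h2, nsmul_multiset_inj he, Multiset.mem_nsmul_of_ne_zero he] using hr

lemma IsCorrespondence.of_pow {g : ℂ[X][Y]} {e : ℕ} (he : e ≠ 0)
    (hf : IsCorrespondence d (g ^ e)) : ∃ k, d = e * k ∧ IsCorrespondence k g := by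
  have h1 : d = e * g.natDegree := by rw [← natDegree_pow, hf.natDegree]
  have h2 : (Bivariate.swap g).natDegree = g.natDegree := by
    apply Nat.eq_of_mul_eq_mul_left (Nat.pos_of_ne_zero he)
    rw [← natDegree_pow, ← map_pow, hf.natDegree_swap, h1]
  refine ⟨g.natDegree, h1, ?_⟩
  have hs := sliceLeft_pow le_rfl h2.le e
  have hs' := sliceLeft_pow h2.le (by rw [swap_swap_apply]) e
  rw [isCorrespondence_iff] at hf ⊢
  simp only [sliceRight_eq, map_pow] at hf ⊢
  rw [h1] at hf
  refine ⟨?_, ?_, fun a ha => hf.2.2.1 a ?_, fun a ha => hf.2.2.2 a ?_⟩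
  · filter_upwards [hf.1] with x hx
    rw [Polynomial.map_pow, roots_pow, Multiset.card_nsmul] at hx
    exact Nat.eq_of_mul_eq_mul_left (Nat.pos_of_ne_zero he) hx
  · filter_upwards [hf.2.1] with x hx
    rw [eval_pow, roots_pow, Multiset.card_nsmul] at hx
    exact Nat.eq_of_mul_eq_mul_left (Nat.pos_of_ne_zero he) hx
  · rw [hs, ha, zero_pow he]
  · rw [hs', ha, zero_pow he]

end TupleCorrespondence

/-! ### The coefficient matrix and its rank. -/

namespace TupleCorrespondence

open Polynomial.Bivariate Matrix

/-- The matrix of coefficients of `f`, in increasing order of exponents. -/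
noncomputable def coefMat (d : ℕ) (f : ℂ[X][Y]) : Matrix (Fin (d + 1)) (Fin (d + 1)) ℂ :=
  Matrix.of fun i j => coef f i j

/-- The point of the rational normal curve of degree `d` with parameter `u`. -/
noncomputable def veronese (d : ℕ) (u : ℂ × ℂ) : Fin (d + 1) → ℂ :=
  fun i => u.2 ^ (i : ℕ) * u.1 ^ (d - i)

lemma coefMat_swap (d : ℕ) (f : ℂ[X][Y]) : coefMat d (swap f) = (coefMat d f)ᵀ := by
  ext i j
  exact coef_swap f i j

lemma rank_coeffMatrix (d : ℕ) (f : ℂ[X][Y]) : (coeffMatrix d f).rank = (coefMat d f).rank := by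
  rw [← Matrix.rank_submatrix (coefMat d f) Fin.revPerm Fin.revPerm]
  congr 1
  ext r c
  simp [coeffMatrix, coefMat, Fin.val_rev]

lemma bihomog_eq_dotProduct (d : ℕ) (f : ℂ[X][Y]) (u v : ℂ × ℂ) :
    bihomog d f u v = veronese d u ⬝ᵥ coefMat d f *ᵥ veronese d v := by
  simp only [bihomog, dotProduct, mulVec, veronese, coefMat, Matrix.of_apply, Finset.mul_sum]
  rw [Finset.sum_range]
  refine Finset.sum_congr rfl fun i _ => ?_
  rw [Finset.sum_range]
  refine Finset.sum_congr rfl fun j _ => ?_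
  ring

lemma coeff_sliceRight (d : ℕ) (f : ℂ[X][Y]) (q : OnePoint ℂ) (i : Fin (d + 1)) :
    (sliceRight d f q).coeff i = (coefMat d f *ᵥ veronese d (homCoord q)) i := by
  rw [sliceRight_eq, coeff_sliceLeft, if_pos (by omega), Finset.sum_range]
  simp only [mulVec, dotProduct, coefMat, Matrix.of_apply, coef_swap, veronese]

lemma natDegree_sliceRight_le (d : ℕ) (f : ℂ[X][Y]) (q : OnePoint ℂ) :
    (sliceRight d f q).natDegree ≤ d := by
  rw [sliceRight_eq]
  exact natDegree_sliceLeft_le _ _ _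

lemma ext_of_natDegree_le {d : ℕ} {P Q : ℂ[X]} (hP : P.natDegree ≤ d) (hQ : Q.natDegree ≤ d)
    (h : ∀ i : Fin (d + 1), P.coeff i = Q.coeff i) : P = Q := by
  ext n
  by_cases hn : n ≤ d
  · exact h ⟨n, by omega⟩
  · rw [coeff_eq_zero_of_natDegree_lt (by omega), coeff_eq_zero_of_natDegree_lt (by omega)]

lemma sphereRoots_C_mul (d : ℕ) {c : ℂ} (hc : c ≠ 0) (P : ℂ[X]) :
    sphereRoots d (C c * P) = sphereRoots d P := by
  rw [sphereRoots, sphereRoots, roots_C_mul _ hc, natDegree_C_mul hc]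

lemma count_coe_sphereRoots [DecidableEq (OnePoint ℂ)] (d : ℕ) (P : ℂ[X]) (z : ℂ) :
    (sphereRoots d P).count (z : OnePoint ℂ) = P.rootMultiplicity z := by
  classical
  rw [sphereRoots, Multiset.count_add, Multiset.count_replicate,
    if_neg (OnePoint.coe_ne_infty z).symm, add_zero, Multiset.count_map_eq_count'
      (fun z : ℂ => (z : OnePoint ℂ)) _ OnePoint.coe_injective, count_roots]

/-- The finite roots with multiplicity already determine a polynomial over `ℂ` up to a constant. -/
lemma exists_eq_C_mul_of_sphereRoots_eq {d : ℕ} {P Q : ℂ[X]} (hQ : Q ≠ 0)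
    (h : sphereRoots d P = sphereRoots d Q) : ∃ c : ℂ, P = C c * Q := by
  classical
  have hr : P.roots = Q.roots := by
    ext z
    rw [count_roots, count_roots, ← count_coe_sphereRoots d, h, count_coe_sphereRoots]
  refine ⟨P.leadingCoeff / Q.leadingCoeff, ?_⟩
  calc P = C P.leadingCoeff * (Q.roots.map fun a => X - C a).prod := by
        rw [← hr]
        exact (IsAlgClosed.splits P).eq_prod_roots
    _ = C (P.leadingCoeff / Q.leadingCoeff) *
        (C Q.leadingCoeff * (Q.roots.map fun a => X - C a).prod) := by
        rw [← mul_assoc, ← C_mul, div_mul_cancel₀ _ (leadingCoeff_ne_zero.2 hQ)]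
    _ = _ := by rw [← (IsAlgClosed.splits Q).eq_prod_roots]

variable {d : ℕ} {f : ℂ[X][Y]}

lemma preimageList_eq_of_rank_eq_two (hf : IsCorrespondence d f) (hr : (coefMat d f).rank = 2)
    {x y y' : OnePoint ℂ} (hy : y ∈ imageList d f x) (hy' : y' ∈ imageList d f x) :
    preimageList d f y = preimageList d f y' := by
  rw [mem_imageList (hf.sliceLeft_ne_zero x), bihomog_eq_dotProduct] at hy hy'
  -- Pairing with `v(x)` on the column space; it is nonzero since otherwise the line over `x` would
  -- lie in the completion.
  let φ : LinearMap.range (coefMat d f).mulVecLin →ₗ[ℂ] ℂ :=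
    (dotProductBilin ℂ ℂ (veronese d (homCoord x))).comp
      (LinearMap.range (coefMat d f).mulVecLin).subtype
  have hφ : φ ≠ 0 := by
    intro h
    apply hf.sliceLeft_ne_zero x
    rw [← forall_mem_completion_iff]
    intro q
    rw [mem_completion, bihomog_eq_dotProduct]
    exact LinearMap.congr_fun h ⟨_, veronese d (homCoord q), rfl⟩
  have hker : Module.finrank ℂ (LinearMap.ker φ) = 1 := by
    have h1 := φ.finrank_range_add_finrank_ker
    rw [LinearMap.range_eq_top.2 (LinearMap.surjective hφ), finrank_top,
      Module.finrank_self] at h1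
    change _ = (coefMat d f).rank at h1
    omega
  let v : LinearMap.ker φ := ⟨⟨_, veronese d (homCoord y), rfl⟩, hy⟩
  let v' : LinearMap.ker φ := ⟨⟨_, veronese d (homCoord y'), rfl⟩, hy'⟩
  have hv : v ≠ 0 := by
    intro h
    apply hf.sliceRight_ne_zero y
    refine ext_of_natDegree_le (natDegree_sliceRight_le d f y) (Nat.zero_le d) fun i => ?_
    rw [coeff_sliceRight, coeff_zero]
    exact congrFun (congrArg (fun w : LinearMap.ker φ => (w : Fin (d + 1) → ℂ)) h) i
  obtain ⟨c, hc⟩ := (finrank_eq_one_iff_of_nonzero' v hv).1 hker v'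
  have hP : sliceRight d f y' = C c * sliceRight d f y := by
    refine ext_of_natDegree_le (natDegree_sliceRight_le d f y')
      ((natDegree_C_mul_le _ _).trans (natDegree_sliceRight_le d f y)) fun i => ?_
    rw [coeff_C_mul, coeff_sliceRight, coeff_sliceRight]
    exact (congrFun (congrArg (fun w : LinearMap.ker φ => (w : Fin (d + 1) → ℂ)) hc) i).symm
  have hc0 : c ≠ 0 := by
    rintro rfl
    exact hf.sliceRight_ne_zero y' (by rw [hP, C_0, zero_mul])
  rw [preimageList, preimageList, hP, sphereRoots_C_mul d hc0]

lemma isMapOfTuples_of_rank_eq_two (hf : IsCorrespondence d f) (hr : (coefMat d f).rank = 2) :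
    IsMapOfTuples d f := by
  refine ⟨hf, fun x y hy y' hy' => preimageList_eq_of_rank_eq_two hf hr hy hy',
    fun y x hx x' hx' => ?_⟩
  rw [preimageList_eq] at hx hx'
  rw [← preimageList_swap, ← preimageList_swap]
  exact preimageList_eq_of_rank_eq_two hf.swap
    (by rw [coefMat_swap, Matrix.rank_transpose, hr]) hx hx'

lemma exists_mem_preimageList (hd : d ≠ 0) (f : ℂ[X][Y]) (q : OnePoint ℂ) :
    ∃ x, x ∈ preimageList d f q := by
  by_contra! h
  have h0 := Multiset.eq_zero_of_forall_notMem h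
  have h1 := congrArg Multiset.card h0
  rw [preimageList, sphereRoots, Multiset.card_add, Multiset.card_map, Multiset.card_replicate,
    ← (IsAlgClosed.splits _).natDegree_eq_card_roots, Multiset.card_zero] at h1
  omega

/-- If every `A v(q)` is a multiple of one vector, a point `x` above infinity is orthogonal to that
vector, so the whole line over `x` lies in the completion. -/
lemma two_le_rank (hd : d ≠ 0) (hf : IsCorrespondence d f) : 2 ≤ (coefMat d f).rank := by
  by_contra! hlt
  obtain ⟨x, hx⟩ := exists_mem_preimageList hd f OnePoint.infty
  rw [preimageList_eq, mem_imageList (hf.swap.sliceLeft_ne_zero _), bihomog_swap] at hx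
  have hle : Module.finrank ℂ (LinearMap.range (coefMat d f).mulVecLin) ≤ 1 :=
    Nat.le_of_lt_succ hlt
  obtain ⟨v, hv⟩ := finrank_le_one_iff.1 hle
  obtain ⟨a, ha⟩ := hv ⟨_, veronese d (homCoord OnePoint.infty), rfl⟩
  replace ha : a • (v : Fin (d + 1) → ℂ) = coefMat d f *ᵥ veronese d (homCoord OnePoint.infty) :=
    congrArg Subtype.val ha
  have ha0 : a ≠ 0 := by
    rintro rfl
    apply hf.sliceRight_ne_zero OnePoint.infty
    refine ext_of_natDegree_le (natDegree_sliceRight_le d f _) (Nat.zero_le d) fun i => ?_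
    rw [coeff_sliceRight, ← ha]
    simp
  rw [bihomog_eq_dotProduct, ← ha, dotProduct_smul, smul_eq_mul, mul_eq_zero,
    or_iff_right ha0] at hx
  apply hf.sliceLeft_ne_zero x
  rw [← forall_mem_completion_iff]
  intro q
  obtain ⟨b, hb⟩ := hv ⟨_, veronese d (homCoord q), rfl⟩
  replace hb : b • (v : Fin (d + 1) → ℂ) = coefMat d f *ᵥ veronese d (homCoord q) :=
    congrArg Subtype.val hb
  rw [mem_completion, bihomog_eq_dotProduct, ← hb, dotProduct_smul, hx, smul_zero]

/-- A row combination `ℓ` that kills the coefficients of `P` turns `A` into a polynomial in `y` of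
degree at most `d` vanishing at the `d` distinct roots of `Q`, hence a multiple of `Q`. Such `ℓ`
form a hyperplane, so the row space is spanned by `Q` and one further row. -/
lemma rank_le_two_of_slices_proportional {P Q : ℂ[X]} (hQ : Q ≠ 0) (hQd : Q.natDegree = d)
    (hroots : Q.roots.Nodup) (hP : P ≠ 0) (hPd : P.natDegree ≤ d)
    (h : ∀ y ∈ Q.roots, ∃ c : ℂ, sliceRight d f (y : OnePoint ℂ) = C c * P) :
    (coefMat d f).rank ≤ 2 := by
  let u : Fin (d + 1) → ℂ := fun i => P.coeff i
  obtain ⟨ℓ₀, hℓ₀⟩ : ∃ ℓ : Fin (d + 1) → ℂ, ℓ ⬝ᵥ u = 1 := by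
    have : ∃ i, u i ≠ 0 := by
      by_contra! hu
      exact hP (ext_of_natDegree_le hPd (Nat.zero_le d) fun i => by rw [coeff_zero]; exact hu i)
    obtain ⟨i, hi⟩ := this
    exact ⟨Pi.single i (u i)⁻¹, by rw [single_dotProduct, inv_mul_cancel₀ hi]⟩
  let q : Fin (d + 1) → ℂ := fun j => Q.coeff j
  have hker : ∀ ℓ : Fin (d + 1) → ℂ, ℓ ⬝ᵥ u = 0 → ∃ a : ℂ, ℓ ᵥ* coefMat d f = a • q := by
    intro ℓ hℓ
    let T : ℂ[X] := ∑ j : Fin (d + 1), C ((ℓ ᵥ* coefMat d f) j) * X ^ (j : ℕ)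
    have hT : ∀ j : Fin (d + 1), T.coeff j = (ℓ ᵥ* coefMat d f) j := by
      intro j
      simp only [T, finsetSum_coeff, coeff_C_mul, coeff_X_pow, Fin.val_inj]
      simp
    have hTd : T.natDegree ≤ d := natDegree_sum_le_of_forall_le _ _ fun j _ =>
      (natDegree_C_mul_X_pow_le _ _).trans (by omega)
    have heval : ∀ y ∈ Q.roots, T.eval y = 0 := by
      intro y hy
      obtain ⟨c, hc⟩ := h y hy
      have h1 : T.eval y = ℓ ᵥ* coefMat d f ⬝ᵥ veronese d (homCoord (y : OnePoint ℂ)) := by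
        simp [T, eval_finsetSum, dotProduct, veronese]
      have h2 : coefMat d f *ᵥ veronese d (homCoord (y : OnePoint ℂ)) = c • u := by
        ext i
        rw [← coeff_sliceRight, hc, coeff_C_mul]
        rfl
      rw [h1, ← dotProduct_mulVec, h2, dotProduct_smul, hℓ, smul_zero]
    obtain ⟨a, ha⟩ : ∃ a : ℂ, T = C a * Q := by
      by_cases hT0 : T = 0
      · exact ⟨0, by simp [hT0]⟩
      have hdvd : Q ∣ T := by
        refine (IsAlgClosed.splits Q).dvd_of_roots_le_roots hQ ?_
        rw [Multiset.le_iff_subset hroots]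
        intro y hy
        rw [mem_roots hT0, IsRoot.def, heval y hy]
      obtain ⟨A, hA⟩ := hdvd
      have hA0 : A ≠ 0 := by
        rintro rfl
        exact hT0 (by rw [hA, mul_zero])
      have hdeg : T.natDegree = Q.natDegree + A.natDegree := by rw [hA, natDegree_mul hQ hA0]
      refine ⟨A.coeff 0, ?_⟩
      rw [← eq_C_of_natDegree_eq_zero (by omega : A.natDegree = 0), hA, mul_comm]
    refine ⟨a, funext fun j => ?_⟩
    rw [← hT, ha, coeff_C_mul]
    rfl
  have hspan : LinearMap.range (coefMat d f)ᵀ.mulVecLin ≤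
      Submodule.span ℂ (({ℓ₀ ᵥ* coefMat d f, q} : Finset (Fin (d + 1) → ℂ)) : Set _) := by
    rintro _ ⟨ℓ, rfl⟩
    -- Projection of `ℓ` onto the hyperplane along `ℓ₀`, which is normalised by `ℓ₀ ⬝ᵥ u = 1`.
    obtain ⟨a, ha⟩ := hker (ℓ - (ℓ ⬝ᵥ u) • ℓ₀) (by
      rw [sub_dotProduct, smul_dotProduct, hℓ₀, smul_eq_mul, mul_one, sub_self])
    rw [sub_vecMul, smul_vecMul, sub_eq_iff_eq_add] at ha
    rw [mulVecLin_apply, mulVec_transpose, ha, Finset.coe_pair]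
    exact Submodule.mem_span_pair.2 ⟨ℓ ⬝ᵥ u, a, add_comm _ _⟩
  rw [← Matrix.rank_transpose]
  exact ((Submodule.finrank_mono hspan).trans (finrank_span_finset_le_card _)).trans
    Finset.card_le_two

end TupleCorrespondence

/-! ### Irreducible factors and multiplicities over a generic point. -/

namespace TupleCorrespondence

open Polynomial.Bivariate

/-- The polynomial `r` is the resultant in `y`: Gauss's lemma makes `p` and `q` coprime over
`RatFunc ℂ`, so it is nonzero, and it lies in the ideal generated by `p` and `q`. -/
lemma exists_ne_zero_forall_common_zero {p q : ℂ[X][Y]} (hp : Irreducible p)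
    (hp0 : p.natDegree ≠ 0) (hpq : ¬ p ∣ q) :
    ∃ r : ℂ[X], r ≠ 0 ∧ ∀ x y, p.evalEval x y = 0 → q.evalEval x y = 0 → r.eval x = 0 := by
  have hprim := hp.isPrimitive hp0
  have hirr := (hprim.irreducible_iff_irreducible_map_fraction_map (K := RatFunc ℂ)).1 hp
  have hcop : IsCoprime (p.map (algebraMap ℂ[X] (RatFunc ℂ)))
      (q.map (algebraMap ℂ[X] (RatFunc ℂ))) :=
    (hirr.isCoprime_or_dvd _).resolve_right fun h =>
      hpq (hprim.dvd_of_fraction_map_dvd_fraction_map h)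
  have hres := resultant_ne_zero _ _ hcop
  have hinj := IsFractionRing.injective ℂ[X] (RatFunc ℂ)
  rw [natDegree_map_eq_of_injective hinj, natDegree_map_eq_of_injective hinj,
    resultant_map_map] at hres
  obtain ⟨a, b, -, -, hab⟩ := exists_mul_add_mul_eq_C_resultant p q le_rfl le_rfl (Or.inl hp0)
  refine ⟨p.resultant q, fun h => hres (by rw [h, map_zero]), fun x y hx hy => ?_⟩
  have := congrArg (evalEval x y) hab
  rw [evalEval_add, evalEval_mul, evalEval_mul, hx, hy, evalEval_C] at this
  rw [← this]
  ring

lemma rootMultiplicity_pow_mul {P H : ℂ[X]} {a : ℂ} (hP : P.eval a = 0)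
    (hP' : P.derivative.eval a ≠ 0) (hH : H.eval a ≠ 0) (e : ℕ) :
    (P ^ e * H).rootMultiplicity a = e := by
  have hP0 : P ≠ 0 := by
    rintro rfl
    simp at hP'
  have hH0 : H ≠ 0 := by
    rintro rfl
    simp at hH
  have h1 : P.rootMultiplicity a = 1 := by
    apply le_antisymm
    · by_contra! h
      exact hP' ((one_lt_rootMultiplicity_iff_isRoot hP0).1 h).2
    · exact (rootMultiplicity_pos hP0).2 hP
  rw [rootMultiplicity_mul (mul_ne_zero (pow_ne_zero e hP0) hH0), ← count_roots (P ^ e),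
    roots_pow, Multiset.count_nsmul, count_roots, h1, rootMultiplicity_eq_zero hH]
  simp

lemma not_dvd_derivative {p : ℂ[X][Y]} (hp0 : p.natDegree ≠ 0) : ¬ p ∣ derivative p := by
  intro h
  by_cases hd : derivative p = 0
  · exact hp0 (derivative_eq_zero.1 hd)
  · exact absurd (natDegree_le_of_dvd h hd) (not_le.2 (natDegree_derivative_lt hp0))

lemma swap_dvd_swap {p q : ℂ[X][Y]} (h : p ∣ q) : swap p ∣ swap q := by
  obtain ⟨g, rfl⟩ := h
  exact ⟨swap g, map_mul _ _ _⟩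

lemma irreducible_swap {p : ℂ[X][Y]} (hp : Irreducible p) : Irreducible (swap p) :=
  (MulEquiv.irreducible_iff (swap (R := ℂ))).2 hp

variable {d : ℕ} {f : ℂ[X][Y]}

lemma IsCorrespondence.sliceLeft_coe (hf : IsCorrespondence d f) (x : ℂ) :
    sliceLeft d f x = f.map (evalRingHom x) :=
  TupleCorrespondence.sliceLeft_coe hf.natDegree.le hf.natDegree_swap.le x

lemma IsCorrespondence.sliceRight_coe (hf : IsCorrespondence d f) (y : ℂ) :
    sliceRight d f y = f.eval (C y) := by
  rw [sliceRight_eq, hf.swap.sliceLeft_coe, map_evalRingHom_swap]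

/-- A factor in `x` alone would vanish on a vertical line. -/
lemma IsCorrespondence.natDegree_ne_zero_of_dvd (hf : IsCorrespondence d f) {p : ℂ[X][Y]}
    (hp : Irreducible p) (hpf : p ∣ f) : p.natDegree ≠ 0 := by
  intro h0
  obtain ⟨r, rfl⟩ : ∃ r, p = C r := ⟨_, eq_C_of_natDegree_eq_zero h0⟩
  have hr : r.degree ≠ 0 := by
    intro h
    exact hp.not_isUnit ((Polynomial.isUnit_iff_degree_eq_zero.2 h).map C)
  obtain ⟨a, ha⟩ := IsAlgClosed.exists_root r hr
  apply hf.sliceLeft_ne_zero (a : OnePoint ℂ)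
  obtain ⟨g, rfl⟩ := hpf
  rw [hf.sliceLeft_coe, Polynomial.map_mul, map_C, coe_evalRingHom, ha, C_0, zero_mul]

/-- Write `f = p ^ e * h`. Where `h` and both partial derivatives of `p` are nonzero, a zero of `p`
is simple in each variable, so `f` vanishes there to order exactly `e` in each. -/
lemma eventually_rootMultiplicity_eq (hf : IsCorrespondence d f) {p : ℂ[X][Y]}
    (hp : Irreducible p) (hpf : p ∣ f) {e : ℕ} (he : emultiplicity p f = e) :
    ∀ᶠ x : ℂ in Filter.cofinite, ∀ y : ℂ, p.evalEval x y = 0 →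
      (f.map (evalRingHom x)).rootMultiplicity y = e ∧
        (f.eval (C y)).rootMultiplicity x = e := by
  have hp0 := hf.natDegree_ne_zero_of_dvd hp hpf
  have hp0' := hf.swap.natDegree_ne_zero_of_dvd (irreducible_swap hp) (swap_dvd_swap hpf)
  obtain ⟨⟨h, rfl⟩, hnd⟩ := emultiplicity_eq_coe.1 he
  have hph : ¬ p ∣ h := fun ⟨h', hh⟩ => hnd ⟨h', by rw [hh, pow_succ, mul_assoc]⟩
  have hpx : ¬ p ∣ swap (derivative (swap p)) := fun hd => by
    have := swap_dvd_swap hd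
    rw [swap_swap_apply] at this
    exact not_dvd_derivative hp0' this
  -- The outer variable is `y`, so these factors are `h`, `∂p/∂y` and `∂p/∂x`; their product meets
  -- `p = 0` over finitely many `x` only.
  have hnd' : ¬ p ∣ h * derivative p * swap (derivative (swap p)) := fun hd =>
    ((hp.prime.dvd_or_dvd hd).elim (fun hd => (hp.prime.dvd_or_dvd hd).elim hph
      (not_dvd_derivative hp0)) hpx)
  obtain ⟨r, hr, hr'⟩ := exists_ne_zero_forall_common_zero hp hp0 hnd'
  filter_upwards [eventually_eval_ne_zero hr] with x hx y hxy
  have hne := mt (hr' x y hxy) hx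
  rw [evalEval_mul, evalEval_mul, evalEval_swap, mul_eq_zero, mul_eq_zero, not_or, not_or] at hne
  constructor
  · rw [Polynomial.map_mul, Polynomial.map_pow]
    apply rootMultiplicity_pow_mul
    · rw [map_evalRingHom_eval, hxy]
    · rw [derivative_map, map_evalRingHom_eval]
      exact hne.1.2
    · rw [map_evalRingHom_eval]
      exact hne.1.1
  · rw [eval_mul, eval_pow]
    apply rootMultiplicity_pow_mul
    · exact hxy
    · rw [← map_evalRingHom_swap, derivative_map, map_evalRingHom_eval]
      exact hne.2
    · exact hne.1.1

lemma eventually_exists_zero {p : ℂ[X][Y]} (hp0 : p.natDegree ≠ 0) :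
    ∀ᶠ x : ℂ in Filter.cofinite, ∃ y : ℂ, p.evalEval x y = 0 := by
  have hp : p ≠ 0 := by
    rintro rfl
    simp at hp0
  filter_upwards [eventually_natDegree_map hp] with x hx
  obtain ⟨y, hy⟩ := IsAlgClosed.exists_root (p.map (evalRingHom x)) fun h =>
    hp0 (by rw [← hx, natDegree_eq_zero_iff_degree_le_zero, h])
  exact ⟨y, by rw [← map_evalRingHom_eval]; exact hy⟩

lemma IsCorrespondence.coe_mem_imageList (hf : IsCorrespondence d f) {x y : ℂ} :
    (y : OnePoint ℂ) ∈ imageList d f x ↔ f.evalEval x y = 0 := by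
  rw [mem_imageList (hf.sliceLeft_ne_zero _), bihomog_coe, hf.sliceLeft_coe,
    map_evalRingHom_eval]

lemma IsMapOfTuples.emultiplicity_eq (hf : IsMapOfTuples d f) {p q : ℂ[X][Y]}
    (hp : Irreducible p) (hpf : p ∣ f) (hq : Irreducible q) (hqf : q ∣ f) :
    emultiplicity p f = emultiplicity q f := by
  classical
  have hc := hf.isCorrespondence
  obtain ⟨m, hm⟩ := ENat.ne_top_iff_exists.1 (finiteMultiplicity_iff_emultiplicity_ne_top.1
    (FiniteMultiplicity.of_prime_left hp.prime hc.ne_zero))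
  obtain ⟨n, hn⟩ := ENat.ne_top_iff_exists.1 (finiteMultiplicity_iff_emultiplicity_ne_top.1
    (FiniteMultiplicity.of_prime_left hq.prime hc.ne_zero))
  obtain ⟨x, ⟨hx1, hx2⟩, ⟨y, hy⟩, z, hz⟩ :=
    (((eventually_rootMultiplicity_eq hc hp hpf hm.symm).and
      (eventually_rootMultiplicity_eq hc hq hqf hn.symm)).and
      ((eventually_exists_zero (hc.natDegree_ne_zero_of_dvd hp hpf)).and
        (eventually_exists_zero (hc.natDegree_ne_zero_of_dvd hq hqf)))).exists
  -- Both `y` on `p = 0` and `z` on `q = 0` are images of the same `x`, so `x` occurs equally often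
  -- in their preimage lists.
  have hyz := hf.left x y (hc.coe_mem_imageList.2 (by
      obtain ⟨g, rfl⟩ := hpf
      rw [evalEval_mul, hy, zero_mul])) z (hc.coe_mem_imageList.2 (by
      obtain ⟨g, rfl⟩ := hqf
      rw [evalEval_mul, hz, zero_mul]))
  replace hyz := congrArg (Multiset.count (x : OnePoint ℂ)) hyz
  rw [preimageList, preimageList, count_coe_sphereRoots, count_coe_sphereRoots,
    hc.sliceRight_coe, hc.sliceRight_coe, (hx1 y hy).2, (hx2 z hz).2] at hyz
  rw [← hm, ← hn, hyz]

open UniqueFactorizationMonoid in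
lemma exists_eq_pow_of_emultiplicity_eq (hf0 : f ≠ 0) {e : ℕ} (he : e ≠ 0)
    (h : ∀ p, Irreducible p → p ∣ f → emultiplicity p f = e) : ∃ g, f = g ^ e := by
  classical
  let s := normalizedFactors f
  have hs : s = e • s.dedup := by
    ext p
    rw [Multiset.count_nsmul, Multiset.count_dedup]
    split_ifs with hp
    · have h1 := h p (irreducible_of_normalized_factor p hp) (dvd_of_mem_normalizedFactors hp)
      rw [emultiplicity_eq_count_normalizedFactors (irreducible_of_normalized_factor p hp) hf0,
        normalize_normalized_factor p hp] at h1
      rw [mul_one]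
      exact_mod_cast h1
    · rw [Multiset.count_eq_zero_of_notMem hp, mul_zero]
  obtain ⟨u, hu⟩ := prod_normalizedFactors hf0
  change s.prod * _ = _ at hu
  rw [hs, Multiset.prod_nsmul] at hu
  obtain ⟨r, hr, hru⟩ := Polynomial.isUnit_iff.1 u.isUnit
  obtain ⟨c, -, rfl⟩ := Polynomial.isUnit_iff.1 hr
  -- Units of `ℂ[x, y]` are constants, so the leftover unit is also an `e`-th power.
  obtain ⟨t, rfl⟩ := IsAlgClosed.exists_pow_nat_eq c (Nat.pos_of_ne_zero he)
  refine ⟨s.dedup.prod * C (C t), ?_⟩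
  rw [← hu, ← hru, mul_pow, C_pow, C_pow]

open UniqueFactorizationMonoid in
lemma exists_nodup_roots_of_emultiplicity_eq_one (hf : IsCorrespondence d f)
    (h : ∀ p, Irreducible p → p ∣ f → emultiplicity p f = 1) :
    ∃ x : ℂ, Multiset.card (f.map (evalRingHom x)).roots = d ∧
      (f.map (evalRingHom x)).roots.Nodup := by
  classical
  have hall : ∀ᶠ x : ℂ in Filter.cofinite, ∀ p ∈ (normalizedFactors f).toFinset, ∀ y : ℂ,
      p.evalEval x y = 0 → (f.map (evalRingHom x)).rootMultiplicity y = 1 := by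
    rw [Filter.eventually_all_finset]
    intro p hp
    rw [Multiset.mem_toFinset] at hp
    have hpi := irreducible_of_normalized_factor p hp
    have hpd := dvd_of_mem_normalizedFactors hp
    filter_upwards [eventually_rootMultiplicity_eq hf hpi hpd (e := 1) (h p hpi hpd)]
      with x hx y hy
    exact (hx y hy).1
  obtain ⟨x, hx, hcard⟩ := (hall.and hf.generic_left).exists
  refine ⟨x, hcard, ?_⟩
  rw [Multiset.nodup_iff_count_le_one]
  intro y
  rw [count_roots]
  by_cases hy : f.evalEval x y = 0
  · obtain ⟨u, hu⟩ := prod_normalizedFactors hf.ne_zero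
    have hu0 : (u : ℂ[X][Y]).evalEval x y ≠ 0 := (u.isUnit.map (evalEvalRingHom x y)).ne_zero
    rw [← hu, evalEval_mul, mul_eq_zero, or_iff_left hu0, evalEval_multiset_prod,
      Multiset.prod_eq_zero_iff, Multiset.mem_map] at hy
    obtain ⟨p, hp, hpy⟩ := hy
    exact (hx p (Multiset.mem_toFinset.2 hp) y hpy).le
  · rw [← map_evalRingHom_eval] at hy
    rw [rootMultiplicity_eq_zero hy]
    exact zero_le_one

lemma IsMapOfTuples.rank_le_two (hf : IsMapOfTuples d f) (hd : d ≠ 0) {x : ℂ}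
    (hcard : Multiset.card (f.map (evalRingHom x)).roots = d)
    (hnodup : (f.map (evalRingHom x)).roots.Nodup) : (coefMat d f).rank ≤ 2 := by
  have hc := hf.isCorrespondence
  obtain ⟨y₀, hy₀⟩ := Multiset.card_pos_iff_exists_mem.1 (by rw [hcard]; omega)
  have hne : f.map (evalRingHom x) ≠ 0 := ne_zero_of_mem_roots hy₀
  have hmem : ∀ y ∈ (f.map (evalRingHom x)).roots, (y : OnePoint ℂ) ∈ imageList d f x := by
    intro y hy
    rwa [hc.coe_mem_imageList, ← map_evalRingHom_eval, ← IsRoot.def, ← mem_roots hne]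
  refine rank_le_two_of_slices_proportional hne ?_ hnodup (hc.sliceRight_ne_zero y₀)
    (natDegree_sliceRight_le d f _) fun y hy =>
    exists_eq_C_mul_of_sphereRoots_eq (hc.sliceRight_ne_zero _)
      (hf.left x y (hmem y hy) y₀ (hmem y₀ hy₀))
  rw [(IsAlgClosed.splits _).natDegree_eq_card_roots, hcard]

end TupleCorrespondence

/-! ### The dichotomy on the common multiplicity, and the theorem. -/

namespace TupleCorrespondence

variable {d : ℕ} {f : ℂ[X][Y]}

lemma IsMapOfTuples.exists_pow_or_rank_eq_two (hf : IsMapOfTuples d f) (hd : d ≠ 0) :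
    (∃ k : ℕ, k ∣ d ∧ k ≠ d ∧ ∃ g : ℂ[X][Y], IsMapOfTuples k g ∧ f = g ^ (d / k)) ∨
      (coefMat d f).rank = 2 := by
  have hc := hf.isCorrespondence
  have hunit : ¬ IsUnit f := fun h => hd (by rw [← hc.natDegree, natDegree_eq_zero_of_isUnit h])
  obtain ⟨p, hp, hpf⟩ := WfDvdMonoid.exists_irreducible_factor hunit hc.ne_zero
  obtain ⟨e, he⟩ := ENat.ne_top_iff_exists.1 (finiteMultiplicity_iff_emultiplicity_ne_top.1
    (FiniteMultiplicity.of_prime_left hp.prime hc.ne_zero))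
  have hall : ∀ q, Irreducible q → q ∣ f → emultiplicity q f = e := fun q hq hqf => by
    rw [he, hf.emultiplicity_eq hq hqf hp hpf]
  have he0 : e ≠ 0 := by
    rintro rfl
    exact emultiplicity_ne_zero.2 hpf he.symm
  obtain rfl | he1 := eq_or_ne e 1
  · right
    obtain ⟨x, hx, hx'⟩ := exists_nodup_roots_of_emultiplicity_eq_one hc hall
    exact le_antisymm (hf.rank_le_two hd hx hx') (two_le_rank hd hc)
  · left
    obtain ⟨g, rfl⟩ := exists_eq_pow_of_emultiplicity_eq hc.ne_zero he0 hall
    obtain ⟨k, rfl, hg⟩ := hc.of_pow he0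
    have hk : 0 < k := Nat.pos_of_ne_zero (right_ne_zero_of_mul hd)
    refine ⟨k, Dvd.intro_left e rfl, fun h => he1 ?_, g, (isMapOfTuples_pow_iff he0 hg hc).1 hf, ?_⟩
    · exact Nat.eq_of_mul_eq_mul_right hk (by rw [one_mul, ← h])
    · rw [Nat.mul_div_cancel _ hk]

end TupleCorrespondence

theorem theorem2p4 (d : ℕ) (hd : 2 ≤ d) (f : ℂ[X][Y])
    (hf : TupleCorrespondence.IsCorrespondence d f) :
    TupleCorrespondence.IsMapOfTuples d f ↔
      (∃ k : ℕ, k ∣ d ∧ k ≠ d ∧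
        ∃ g : ℂ[X][Y], TupleCorrespondence.IsMapOfTuples k g ∧ f = g ^ (d / k)) ∨
      (TupleCorrespondence.coeffMatrix d f).rank = 2 := by
  have hd0 : d ≠ 0 := by omega
  rw [TupleCorrespondence.rank_coeffMatrix]
  constructor
  · exact fun h => h.exists_pow_or_rank_eq_two hd0
  · rintro (⟨k, ⟨e, rfl⟩, -, g, hg, hfg⟩ | hr)
    · have hk : 0 < k := Nat.pos_of_ne_zero (left_ne_zero_of_mul hd0)
      have he : e ≠ 0 := right_ne_zero_of_mul hd0
      rw [Nat.mul_div_cancel_left _ hk] at hfg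
      subst hfg
      rw [mul_comm] at hf ⊢
      exact (TupleCorrespondence.isMapOfTuples_pow_iff he hg.isCorrespondence hf).2 hg
    · exact TupleCorrespondence.isMapOfTuples_of_rank_eq_two hf hr
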